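/- For an integer $k\ge 0$ let $H_k(x)=(-1)^k e^{x^2}\frac{d^k}{dx^k}e^{-x^2}$ be the physicists' Hermite polynomial, and for $k\ge 1$ let $$M_k=(2k)^{1/6}\max_{x\in\mathbb R}\left(H_k(x)^2e^{-x^2}\right)$$ (the maximum is attained). Put $$C_k=\frac{2k\sqrt{4k-2}\;(k!)^2}{\sqrt{8k^2-8k+3}\;\big((k/2)!\big)^2}\quad\text{for } k \text{ even},\qquad C_k=\frac{\sqrt{16k^2-16k+6}\;k!\,(k-1)!}{\sqrt{2k-1}\;\big(((k-1)/2)!\big)^2}\quad\text{for } k \text{ odd}.$$ Then for every integer $k\ge 6$, $$\frac{27}{61}\,C_k< M_k<\frac23\,C_k\exp\left(\frac{15}{8}\left(1+\frac{12}{4(2k)^{1/3}-9}\right)\right).$$ Both bounds are sharp up to a constant factor: there is an absolute constant $K>0$ such that, for every $k\ge 6$, the upper bound is at most $K M_k$, and $M_k$ is at most $K$ times the lower bound. -/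

import Mathlib

open Polynomial

noncomputable section

/-- The physicists' Hermite polynomials `H n`, that is
`H n x = (-1) ^ n * exp (x ^ 2) * (d / dx) ^ n exp (- x ^ 2)`.
Differentiating this formula once gives `H (n + 1) = 2 x H n - (H n)'`, and `H 0 = 1`. -/
def physHermite : ℕ → ℝ[X]
  | 0 => 1
  | n + 1 => 2 * X * physHermite n - derivative (physHermite n)

/-- The function `x ↦ (H k x) ^ 2 * exp (- x ^ 2)` on the real line. -/
def weightedSq (k : ℕ) (x : ℝ) : ℝ :=
  ((physHermite k).eval x) ^ 2 * Real.exp (-x ^ 2)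

/-- `M k = (2 k) ^ (1 / 6) * max_x (H k x) ^ 2 exp (- x ^ 2)`. The maximum is written as a supremum;
that it is attained is claimed separately. -/
def hermiteM (k : ℕ) : ℝ :=
  (2 * (k : ℝ)) ^ ((1 : ℝ) / 6) * ⨆ x : ℝ, weightedSq k x

/-- The explicit constant `C k`. The natural-number divisions by 2 are exact in both cases. -/
def hermiteC (k : ℕ) : ℝ :=
  if Even k then
    2 * (k : ℝ) * √(4 * (k : ℝ) - 2) * ((k.factorial : ℕ) : ℝ) ^ 2 /
      (√(8 * (k : ℝ) ^ 2 - 8 * (k : ℝ) + 3) * (((k / 2).factorial : ℕ) : ℝ) ^ 2)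
  else
    √(16 * (k : ℝ) ^ 2 - 16 * (k : ℝ) + 6) * ((k.factorial : ℕ) : ℝ) *
        (((k - 1).factorial : ℕ) : ℝ) /
      (√(2 * (k : ℝ) - 1) * ((((k - 1) / 2).factorial : ℕ) : ℝ) ^ 2)

/-- The lower bound `(27 / 61) C k`. -/
def lowerBd (k : ℕ) : ℝ := 27 / 61 * hermiteC k

/-- The upper bound `(2 / 3) C k exp ((15 / 8) (1 + 12 / (4 (2 k) ^ (1 / 3) - 9)))`. -/
def upperBd (k : ℕ) : ℝ :=
  2 / 3 * hermiteC k *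
    Real.exp (15 / 8 * (1 + 12 / (4 * (2 * (k : ℝ)) ^ ((1 : ℝ) / 3) - 9)))

end

/-!
The Hermite function `u = H_k exp (-x ^ 2 / 2)` solves `u'' + (A - x ^ 2) u = 0` with
`A = 2 k + 1`, and `u ^ 2` is `weightedSq k`. Put `q = A - x ^ 2`.

*Energy.* After the Liouville–Green substitution `w = q ^ (1 / 4) u`, `dt = √q dx`, the energy
`E = w ^ 2 + (dw / dt) ^ 2` satisfies `|E'| ≤ I' E` for an explicit function `I`
(`liouvilleError`), so `E` stays between `E 0 * exp (-I)` and `E 0 * exp I` on `[0, √A)`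
(`liouvilleEnergy_bounds`). At a critical point `E = √q u ^ 2 (1 + x ^ 2 / (4 q ^ 3))`. The initial
value `E 0` is known from `H_k 0` and `H_k' 0`, and equals `C k` up to less than one percent
(`liouvilleEnergy_hermiteFun_zero`).

*Location of the maximum.* Both `I` and the size of `√q` are under control as soon as `q` is
comparable to `A ^ (1 / 3)` at the critical point. The bound from below, `q ^ (3 / 2) ≥ 4 x / 3`
(`critical_point_location`), comes from the decreasing function `q u ^ 2 + u' ^ 2` and holds at
every critical point where `|u|` is largest among the points to its right. The bound from above,
`q ≤ 4.06 A ^ (1 / 3)` at some critical point, is Sturm comparison with a cosine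
(`exists_critical_point_near_turning_point`).

Applied at the global maximum, the first bound gives `M k ≤ 2.006 C k`. At a critical point
satisfying both bounds, the energy estimate gives `M k > (27 / 61) C k`. As the exponential factor
in the upper bound is bounded for `k ≥ 6` (and at least `exp (15 / 8)`), all remaining claims
follow.
-/

/-! ### Hermite polynomials -/

theorem derivative_physHermite_succ (n : ℕ) :
    derivative (physHermite (n + 1)) = C (2 * ((n : ℝ) + 1)) * physHermite n := by
  induction n with
  | zero => simp [physHermite, C_ofNat]
  | succ n ih =>
    rw [physHermite, derivative_sub, ih]
    simp only [derivative_mul, derivative_C, derivative_X, derivative_ofNat]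
    rw [ih, physHermite]
    simp only [map_mul, map_add, map_one, map_natCast, Nat.cast_add, Nat.cast_one, map_ofNat]
    ring

theorem physHermite_succ_succ (n : ℕ) :
    physHermite (n + 2) = 2 * X * physHermite (n + 1) - C (2 * ((n : ℝ) + 1)) * physHermite n := by
  rw [← derivative_physHermite_succ, physHermite]

/-- Hermite's equation `H'' = 2 x H' - 2 n H`. -/
theorem derivative_derivative_physHermite (n : ℕ) :
    derivative (derivative (physHermite n)) =
      2 * X * derivative (physHermite n) - C (2 * (n : ℝ)) * physHermite n := by
  have h := derivative_physHermite_succ n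
  rw [physHermite] at h
  simp only [derivative_sub, derivative_mul, derivative_X, derivative_ofNat, map_mul, map_add,
    map_one, map_ofNat] at h ⊢
  linear_combination -h

theorem physHermite_ne_zero (n : ℕ) : physHermite n ≠ 0 := by
  induction n with
  | zero => simp [physHermite]
  | succ n ih =>
    intro h
    have h1 := derivative_physHermite_succ n
    rw [h, derivative_zero, eq_comm, mul_eq_zero, C_eq_zero] at h1
    rcases h1 with h1 | h1
    · have : (0 : ℝ) ≤ n := n.cast_nonneg
      linarith
    · exact ih h1

theorem eval_neg_physHermite (n : ℕ) (x : ℝ) :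
    (physHermite n).eval (-x) = (-1) ^ n * (physHermite n).eval x := by
  induction n using Nat.twoStepInduction with
  | zero => simp [physHermite]
  | one => simp [physHermite]
  | more n ih1 ih2 =>
    rw [physHermite_succ_succ]
    simp only [eval_sub, eval_mul, eval_ofNat, eval_X, eval_C, ih1, ih2]
    ring

theorem eval_zero_physHermite_even (m : ℕ) :
    (physHermite (2 * m)).eval 0 * (m.factorial : ℝ) = (-1) ^ m * ((2 * m).factorial : ℝ) := by
  induction m with
  | zero => simp [physHermite]
  | succ m ih =>
    rw [show 2 * (m + 1) = 2 * m + 2 by ring, physHermite_succ_succ, Nat.factorial_succ m,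
      Nat.factorial_succ (2 * m + 1), Nat.factorial_succ (2 * m)]
    simp only [eval_sub, eval_mul, eval_ofNat, eval_X, eval_C]
    push_cast
    linear_combination (-2 * (2 * (m : ℝ) + 1) * (m + 1)) * ih

theorem eval_zero_physHermite_odd (m : ℕ) : (physHermite (2 * m + 1)).eval 0 = 0 := by
  have h := eval_neg_physHermite (2 * m + 1) 0
  rw [neg_zero, Odd.neg_one_pow ⟨m, rfl⟩] at h
  linarith

/-! ### Hermite functions -/

/-- The (unnormalised) Hermite function `H n x * exp (-x ^ 2 / 2)`; its square is `weightedSq n`. -/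
noncomputable def hermiteFun (n : ℕ) (x : ℝ) : ℝ :=
  (physHermite n).eval x * Real.exp (-x ^ 2 / 2)

/-- The derivative of `hermiteFun n`, in closed form. -/
noncomputable def hermiteFunDeriv (n : ℕ) (x : ℝ) : ℝ :=
  ((derivative (physHermite n)).eval x - x * (physHermite n).eval x) * Real.exp (-x ^ 2 / 2)

theorem hermiteFun_sq (n : ℕ) (x : ℝ) : hermiteFun n x ^ 2 = weightedSq n x := by
  rw [hermiteFun, weightedSq, mul_pow, ← Real.exp_nat_mul]
  congr 2
  push_cast
  ring

theorem hasDerivAt_exp_neg_sq_div_two (x : ℝ) :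
    HasDerivAt (fun x : ℝ => Real.exp (-x ^ 2 / 2)) (-x * Real.exp (-x ^ 2 / 2)) x := by
  have h : HasDerivAt (fun x : ℝ => -x ^ 2 / 2) (-x) x :=
    ((hasDerivAt_pow 2 x).neg.div_const 2).congr_deriv (by push_cast; ring)
  exact h.exp.congr_deriv (mul_comm _ _)

theorem hasDerivAt_hermiteFun (n : ℕ) (x : ℝ) :
    HasDerivAt (hermiteFun n) (hermiteFunDeriv n x) x := by
  have h := ((physHermite n).hasDerivAt x).mul (hasDerivAt_exp_neg_sq_div_two x)
  refine h.congr_deriv ?_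
  rw [hermiteFunDeriv]
  ring

/-- The equation of the harmonic oscillator, `u'' = -(2 n + 1 - x ^ 2) u`. -/
theorem hasDerivAt_hermiteFunDeriv (n : ℕ) (x : ℝ) :
    HasDerivAt (hermiteFunDeriv n) (-((2 * n + 1 : ℝ) - x ^ 2) * hermiteFun n x) x := by
  have h := (((derivative (physHermite n)).hasDerivAt x).sub
    ((hasDerivAt_id x).mul ((physHermite n).hasDerivAt x))).mul (hasDerivAt_exp_neg_sq_div_two x)
  refine h.congr_deriv ?_
  have h2 := congrArg (eval x) (derivative_derivative_physHermite n)
  simp only [eval_sub, eval_mul, eval_ofNat, eval_X, eval_C] at h2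
  simp only [Pi.sub_apply, Pi.mul_apply, id, h2, hermiteFun]
  ring

theorem tendsto_eval_mul_exp_neg_sq_div_two (p : ℝ[X]) :
    Filter.Tendsto (fun x : ℝ => p.eval x * Real.exp (-x ^ 2 / 2)) Filter.atTop (nhds 0) := by
  have h1 := p.tendsto_div_exp_atTop
  refine squeeze_zero_norm' ?_ (tendsto_norm_zero.comp h1)
  filter_upwards [Filter.eventually_ge_atTop 2] with x hx
  rw [Function.comp_apply, div_eq_mul_inv (eval x p), ← Real.exp_neg, norm_mul, norm_mul]
  refine mul_le_mul_of_nonneg_left ?_ (norm_nonneg _)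
  rw [Real.norm_of_nonneg (Real.exp_pos _).le, Real.norm_of_nonneg (Real.exp_pos _).le,
    Real.exp_le_exp]
  nlinarith

theorem tendsto_hermiteFun (n : ℕ) : Filter.Tendsto (hermiteFun n) Filter.atTop (nhds 0) :=
  tendsto_eval_mul_exp_neg_sq_div_two _

theorem tendsto_id_mul_hermiteFun (n : ℕ) :
    Filter.Tendsto (fun x => x * hermiteFun n x) Filter.atTop (nhds 0) := by
  have h := tendsto_eval_mul_exp_neg_sq_div_two (X * physHermite n)
  simp only [eval_mul, eval_X, mul_assoc] at h
  exact h

theorem tendsto_hermiteFunDeriv (n : ℕ) :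
    Filter.Tendsto (hermiteFunDeriv n) Filter.atTop (nhds 0) := by
  have h := tendsto_eval_mul_exp_neg_sq_div_two
    (derivative (physHermite n) - X * physHermite n)
  simp only [eval_sub, eval_mul, eval_X] at h
  exact h

theorem exists_hermiteFun_ne_zero (n : ℕ) (y : ℝ) : ∃ z, y ≤ z ∧ hermiteFun n z ≠ 0 := by
  by_contra! h
  refine physHermite_ne_zero n (eq_zero_of_infinite_isRoot _ ((Set.Ici_infinite y).mono ?_))
  intro z hz
  simpa [hermiteFun, Real.exp_ne_zero] using h z hz

theorem weightedSq_neg (n : ℕ) (x : ℝ) : weightedSq n (-x) = weightedSq n x := by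
  rw [weightedSq, weightedSq, eval_neg_physHermite, mul_pow, ← pow_mul, mul_comm n 2, pow_mul]
  simp

/-! ### The equation `u'' + (A - x ^ 2) u = 0`: energy of Liouville–Green type -/

/-- The energy `w ^ 2 + (dw / dt) ^ 2` of the Liouville–Green transform `w = q ^ (1 / 4) u`,
`dt = √q dx`, where `q = A - x ^ 2`; here `v` stands for `u'`. -/
noncomputable def liouvilleEnergy (A : ℝ) (u v : ℝ → ℝ) (x : ℝ) : ℝ :=
  √(A - x ^ 2) * u x ^ 2 + (v x - x * u x / (2 * √(A - x ^ 2) ^ 2)) ^ 2 / √(A - x ^ 2)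

/-- The total Liouville–Green error on `[0, x]`, that is
`∫₀ˣ (5 y ^ 2 / (4 q ^ (5 / 2)) + 1 / (2 q ^ (3 / 2))) dy` with `q = A - y ^ 2`, in closed form. -/
noncomputable def liouvilleError (A x : ℝ) : ℝ :=
  5 / 12 * (x ^ 3 / (A * √(A - x ^ 2) ^ 3)) + x / (2 * A * √(A - x ^ 2))

theorem hasDerivAt_sqrt_sub_sq {A x : ℝ} (h : x ^ 2 < A) :
    HasDerivAt (fun x : ℝ => √(A - x ^ 2)) (-x / √(A - x ^ 2)) x := by
  have h1 : HasDerivAt (fun x : ℝ => A - x ^ 2) (-(2 * x)) x := by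
    simpa using (hasDerivAt_pow 2 x).const_sub A
  convert h1.sqrt (by linarith) using 1
  ring

theorem hasDerivAt_liouvilleError {A x : ℝ} (h : x ^ 2 < A) :
    HasDerivAt (liouvilleError A)
      ((5 / 4 * x ^ 2 + √(A - x ^ 2) ^ 2 / 2) / √(A - x ^ 2) ^ 5) x := by
  have hA : 0 < A := lt_of_le_of_lt (sq_nonneg x) h
  have hs : 0 < √(A - x ^ 2) := Real.sqrt_pos.2 (by linarith)
  have hs2 : √(A - x ^ 2) ^ 2 = A - x ^ 2 := Real.sq_sqrt (by linarith)
  have hd := hasDerivAt_sqrt_sub_sq h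
  have h1 := (((hasDerivAt_pow 3 x).div ((hd.pow 3).const_mul A)
    (by simp only [Pi.pow_apply]; positivity)).const_mul
    (5 / 12)).add ((hasDerivAt_id x).div (hd.const_mul (2 * A)) (by positivity))
  refine h1.congr_deriv ?_
  simp only [Pi.pow_apply, id]
  generalize √(A - x ^ 2) = s at *
  obtain rfl : A = s ^ 2 + x ^ 2 := by linarith
  field_simp
  ring

theorem hasDerivAt_liouvilleEnergy {A x : ℝ} {u v : ℝ → ℝ} (hu : HasDerivAt u (v x) x)
    (hv : HasDerivAt v (-(A - x ^ 2) * u x) x) (h : x ^ 2 < A) :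
    HasDerivAt (liouvilleEnergy A u v)
      (-2 * ((5 / 4 * x ^ 2 + √(A - x ^ 2) ^ 2 / 2) / √(A - x ^ 2) ^ 5) *
        (u x * (v x - x * u x / (2 * √(A - x ^ 2) ^ 2)))) x := by
  have hs : 0 < √(A - x ^ 2) := Real.sqrt_pos.2 (by linarith)
  have hs2 : √(A - x ^ 2) ^ 2 = A - x ^ 2 := Real.sq_sqrt (by linarith)
  have hd := hasDerivAt_sqrt_sub_sq h
  have h1 := (hd.mul (hu.pow 2)).add (((hv.sub (((hasDerivAt_id x).mul hu).div
    ((hd.pow 2).const_mul 2)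
      (by simp only [Pi.pow_apply]; positivity))).pow 2).div hd hs.ne')
  refine h1.congr_deriv ?_
  simp only [Pi.pow_apply, Pi.sub_apply, Pi.mul_apply, Pi.div_apply, id, Nat.cast_ofNat,
    Nat.add_one_sub_one, pow_one]
  generalize √(A - x ^ 2) = s at *
  rw [← hs2]
  field_simp
  ring

theorem two_mul_abs_le_liouvilleEnergy {A x : ℝ} (u v : ℝ → ℝ) (h : x ^ 2 < A) :
    2 * |u x * (v x - x * u x / (2 * √(A - x ^ 2) ^ 2))| ≤ liouvilleEnergy A u v x := by
  have hs : 0 < √(A - x ^ 2) := Real.sqrt_pos.2 (by linarith)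
  rw [liouvilleEnergy]
  generalize √(A - x ^ 2) = s at *
  generalize v x - x * u x / (2 * s ^ 2) = w
  have key : s * u x ^ 2 + w ^ 2 / s - 2 * |u x * w| = (s * |u x| - |w|) ^ 2 / s := by
    rw [abs_mul, ← sq_abs (u x), ← sq_abs w]
    field_simp
    ring
  have : 0 ≤ (s * |u x| - |w|) ^ 2 / s := by positivity
  linarith

/-- Gronwall's inequality for the energy, in both directions: `|E'| ≤ I' E`. -/
theorem liouvilleEnergy_bounds {A y : ℝ} {u v : ℝ → ℝ} (hu : ∀ x, HasDerivAt u (v x) x)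
    (hv : ∀ x, HasDerivAt v (-(A - x ^ 2) * u x) x) (hy : 0 ≤ y) (h : y ^ 2 < A) :
    liouvilleEnergy A u v y ≤ liouvilleEnergy A u v 0 * Real.exp (liouvilleError A y) ∧
      liouvilleEnergy A u v 0 * Real.exp (-liouvilleError A y) ≤ liouvilleEnergy A u v y := by
  have hlt : ∀ x ∈ Set.Icc 0 y, x ^ 2 < A := fun x hx =>
    lt_of_le_of_lt (pow_le_pow_left₀ hx.1 hx.2 2) h
  have h0 : liouvilleError A 0 = 0 := by simp [liouvilleError]
  have hI := fun x hx => hasDerivAt_liouvilleError (hlt x hx)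
  have hE := fun x hx => hasDerivAt_liouvilleEnergy (hu x) (hv x) (hlt x hx)
  have hR : ∀ x ∈ Set.Icc 0 y,
      0 ≤ (5 / 4 * x ^ 2 + √(A - x ^ 2) ^ 2 / 2) / √(A - x ^ 2) ^ 5 :=
    fun x _ => by positivity
  have hab := fun x hx => two_mul_abs_le_liouvilleEnergy u v (hlt x hx)
  constructor
  · have hD := fun x hx => (hE x hx).mul (hI x hx).neg.exp
    have hanti := antitoneOn_of_deriv_nonpos (convex_Icc 0 y)
      (fun x hx => (hD x hx).continuousAt.continuousWithinAt)
      (fun x hx => (hD x (interior_subset hx)).differentiableAt.differentiableWithinAt)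
      (fun x hx => by
        rw [(hD x (interior_subset hx)).deriv]
        have := hab x (interior_subset hx)
        have h2 := hR x (interior_subset hx)
        have h3 := neg_abs_le (u x * (v x - x * u x / (2 * √(A - x ^ 2) ^ 2)))
        have h4 := mul_nonneg h2 (show 0 ≤ liouvilleEnergy A u v x +
          2 * (u x * (v x - x * u x / (2 * √(A - x ^ 2) ^ 2))) by linarith)
        have h5 := mul_nonneg h4 (Real.exp_pos ((-liouvilleError A) x)).le
        linarith)
    have := hanti (Set.left_mem_Icc.2 hy) (Set.right_mem_Icc.2 hy) hy
    simp only [Pi.mul_apply, Pi.neg_apply, h0, neg_zero, Real.exp_zero, mul_one] at this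
    rw [Real.exp_neg, ← div_eq_mul_inv, div_le_iff₀ (Real.exp_pos _)] at this
    exact this
  · have hD := fun x hx => (hE x hx).mul (hI x hx).exp
    have hmono := monotoneOn_of_deriv_nonneg (convex_Icc 0 y)
      (fun x hx => (hD x hx).continuousAt.continuousWithinAt)
      (fun x hx => (hD x (interior_subset hx)).differentiableAt.differentiableWithinAt)
      (fun x hx => by
        rw [(hD x (interior_subset hx)).deriv]
        have := hab x (interior_subset hx)
        have h2 := hR x (interior_subset hx)
        have h3 := le_abs_self (u x * (v x - x * u x / (2 * √(A - x ^ 2) ^ 2)))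
        have h4 := mul_nonneg h2 (show 0 ≤ liouvilleEnergy A u v x -
          2 * (u x * (v x - x * u x / (2 * √(A - x ^ 2) ^ 2))) by linarith)
        have h5 := mul_nonneg h4 (Real.exp_pos (liouvilleError A x)).le
        linarith)
    have := hmono (Set.left_mem_Icc.2 hy) (Set.right_mem_Icc.2 hy) hy
    simp only [Pi.mul_apply, h0, Real.exp_zero, mul_one] at this
    rw [Real.exp_neg, ← div_eq_mul_inv, div_le_iff₀ (Real.exp_pos _)]
    exact this

/-! ### Location of the last critical point -/

/-- A critical point to the right of which `|u|` is not larger lies before the turning point `√A`,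
at a distance bounded below. With `S = (A - x ^ 2) u ^ 2 + u' ^ 2` one has `S' = -2 x u ^ 2` and
`S → 0`, so `S x₀` bounds an integral of `u ^ 2` from above, while `u ^ 2` cannot drop faster than
the parabola `u(x₀) ^ 2 (1 - (A - x₀ ^ 2) (x - x₀) ^ 2)`. -/
theorem critical_point_location {A x₀ : ℝ} {u v : ℝ → ℝ} (hA : 0 < A)
    (hu : ∀ x, HasDerivAt u (v x) x) (hv : ∀ x, HasDerivAt v (-(A - x ^ 2) * u x) x)
    (hu0 : Filter.Tendsto u Filter.atTop (nhds 0))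
    (hxu0 : Filter.Tendsto (fun x => x * u x) Filter.atTop (nhds 0))
    (hv0 : Filter.Tendsto v Filter.atTop (nhds 0))
    (hx₀ : 0 ≤ x₀) (hvx₀ : v x₀ = 0) (hux₀ : u x₀ ≠ 0)
    (hmax : ∀ x, x₀ ≤ x → u x ^ 2 ≤ u x₀ ^ 2) :
    x₀ ^ 2 < A ∧ 4 / 3 * x₀ ≤ √(A - x₀ ^ 2) ^ 3 := by
  have hB : 0 < u x₀ ^ 2 := by positivity
  have hq : ∀ x : ℝ, HasDerivAt (fun x : ℝ => A - x ^ 2) (-(2 * x)) x := fun x => by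
    simpa using (hasDerivAt_pow 2 x).const_sub A
  have hS : ∀ x, HasDerivAt (fun x => (A - x ^ 2) * u x ^ 2 + v x ^ 2) (-2 * x * u x ^ 2) x :=
    fun x => (((hq x).mul ((hu x).pow 2)).add ((hv x).pow 2)).congr_deriv (by
      simp only [Pi.pow_apply]
      push_cast
      ring)
  have hSanti : AntitoneOn (fun x => (A - x ^ 2) * u x ^ 2 + v x ^ 2) (Set.Ici 0) :=
    antitoneOn_of_deriv_nonpos (convex_Ici 0)
      (fun x _ => (hS x).continuousAt.continuousWithinAt)
      (fun x _ => (hS x).differentiableAt.differentiableWithinAt)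
      (fun x hx => by
        rw [(hS x).deriv]
        have : 0 ≤ x := interior_subset hx
        have := mul_nonneg this (sq_nonneg (u x))
        linarith)
  have hS0 : Filter.Tendsto (fun x => (A - x ^ 2) * u x ^ 2 + v x ^ 2) Filter.atTop (nhds 0) := by
    have := (((hu0.pow 2).const_mul A).sub (hxu0.pow 2)).add (hv0.pow 2)
    simp only [ne_eq, OfNat.ofNat_ne_zero, not_false_eq_true, zero_pow, mul_zero, sub_zero,
      add_zero] at this
    exact this.congr fun x => by ring
  have hSnn : ∀ x, 0 ≤ x → 0 ≤ (A - x ^ 2) * u x ^ 2 + v x ^ 2 := fun x hx =>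
    le_of_tendsto hS0 (by
      filter_upwards [Filter.eventually_ge_atTop x] with y hy
      exact hSanti hx (hx.trans hy) hy)
  have hQ0 : 0 ≤ A - x₀ ^ 2 := by
    have := hSnn x₀ hx₀
    rw [hvx₀] at this
    nlinarith
  set Q := A - x₀ ^ 2 with hQ
  have hpar : ∀ x, x₀ ≤ x → u x₀ ^ 2 * (1 - Q * (x - x₀) ^ 2) ≤ u x ^ 2 := by
    have hk : ∀ x, HasDerivAt (fun x => u x ^ 2 - u x₀ ^ 2 * (1 - Q * (x - x₀) ^ 2))
        (2 * u x * v x + 2 * u x₀ ^ 2 * Q * (x - x₀)) x := fun x => by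
      have h1 := (((((hasDerivAt_id x).sub_const x₀).pow 2).const_mul Q).const_sub 1).const_mul
        (u x₀ ^ 2)
      refine (((hu x).pow 2).sub h1).congr_deriv ?_
      simp only [id]
      push_cast
      ring
    have hk2 : ∀ x, HasDerivAt (fun x => 2 * u x * v x + 2 * u x₀ ^ 2 * Q * (x - x₀))
        (2 * v x ^ 2 - 2 * (A - x ^ 2) * u x ^ 2 + 2 * u x₀ ^ 2 * Q) x := fun x => by
      have h1 := ((hasDerivAt_id x).sub_const x₀).const_mul (2 * u x₀ ^ 2 * Q)
      refine ((((hu x).const_mul 2).mul (hv x)).add h1).congr_deriv ?_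
      ring
    have hmono2 : MonotoneOn (fun x => 2 * u x * v x + 2 * u x₀ ^ 2 * Q * (x - x₀))
        (Set.Ici x₀) :=
      monotoneOn_of_deriv_nonneg (convex_Ici x₀)
        (fun x _ => (hk2 x).continuousAt.continuousWithinAt)
        (fun x _ => (hk2 x).differentiableAt.differentiableWithinAt)
        (fun x hx => by
          rw [(hk2 x).deriv]
          have hx : x₀ ≤ x := interior_subset hx
          have h1 : (A - x ^ 2) * u x ^ 2 ≤ Q * u x₀ ^ 2 := by
            have h2 : A - x ^ 2 ≤ Q := by nlinarith
            exact mul_le_mul h2 (hmax x hx) (sq_nonneg _) hQ0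
          nlinarith [sq_nonneg (v x)])
    have hmono : MonotoneOn (fun x => u x ^ 2 - u x₀ ^ 2 * (1 - Q * (x - x₀) ^ 2)) (Set.Ici x₀) :=
      monotoneOn_of_deriv_nonneg (convex_Ici x₀)
        (fun x _ => (hk x).continuousAt.continuousWithinAt)
        (fun x _ => (hk x).differentiableAt.differentiableWithinAt)
        (fun x hx => by
          rw [(hk x).deriv]
          have hx : x₀ ≤ x := interior_subset hx
          have := hmono2 (Set.mem_Ici.2 le_rfl) hx hx
          simpa [hvx₀] using this)
    intro x hx
    have := hmono (Set.mem_Ici.2 le_rfl) hx hx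
    simp only [sub_self] at this
    linarith
  have hmain : ∀ t, 0 ≤ t → 2 * x₀ * (t - Q * t ^ 3 / 3) ≤ Q := by
    intro t ht
    have hG : ∀ x, HasDerivAt (fun x => (A - x ^ 2) * u x ^ 2 + v x ^ 2 +
        2 * x₀ * u x₀ ^ 2 * ((x - x₀) - Q * (x - x₀) ^ 3 / 3))
        (-2 * x * u x ^ 2 + 2 * x₀ * u x₀ ^ 2 * (1 - Q * (x - x₀) ^ 2)) x := fun x => by
      have h0 := (hasDerivAt_id x).sub_const x₀
      refine ((hS x).add ((h0.sub (((h0.pow 3).const_mul Q).div_const 3)).const_mul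
        (2 * x₀ * u x₀ ^ 2))).congr_deriv ?_
      simp only [id]
      push_cast
      ring
    have hGanti := antitoneOn_of_deriv_nonpos (convex_Ici x₀)
      (fun x _ => (hG x).continuousAt.continuousWithinAt)
      (fun x _ => (hG x).differentiableAt.differentiableWithinAt)
      (fun x hx => by
        rw [(hG x).deriv]
        have hx : x₀ ≤ x := interior_subset hx
        have h1 := mul_le_mul_of_nonneg_left (hpar x hx) hx₀
        have h2 := mul_le_mul_of_nonneg_right hx (sq_nonneg (u x))
        linarith)
    have h1 := hGanti (Set.mem_Ici.2 le_rfl) (show x₀ ≤ x₀ + t by linarith)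
      (show x₀ ≤ x₀ + t by linarith)
    have h2 := hSnn (x₀ + t) (by linarith)
    simp only [hvx₀, add_sub_cancel_left, sub_self] at h1
    rw [← hQ] at h1
    have h3 : u x₀ ^ 2 * (2 * x₀ * (t - Q * t ^ 3 / 3)) ≤ u x₀ ^ 2 * Q := by linarith
    exact le_of_mul_le_mul_left h3 hB
  have hQpos : 0 < Q := by
    rcases hQ0.lt_or_eq with h | h
    · exact h
    · have h1 := hmain 1 zero_le_one
      rw [← h] at h1 hQ
      have : x₀ = 0 := by linarith
      rw [this] at hQ
      linarith
  refine ⟨by linarith, ?_⟩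
  have hs : 0 < √Q := Real.sqrt_pos.2 hQpos
  have hs2 : √Q ^ 2 = Q := Real.sq_sqrt hQ0
  have h1 := hmain (1 / √Q) (by positivity)
  generalize √Q = s at *
  have h2 : 2 * x₀ * (1 / s - Q * (1 / s) ^ 3 / 3) = 4 / 3 * x₀ / s := by
    rw [← hs2]
    field_simp
    ring
  rw [h2, div_le_iff₀ hs, ← hs2] at h1
  linarith

theorem not_forall_deriv_neg {A x₁ ω : ℝ} {u v : ℝ → ℝ}
    (hu : ∀ x, HasDerivAt u (v x) x) (hv : ∀ x, HasDerivAt v (-(A - x ^ 2) * u x) x)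
    (hu0 : Filter.Tendsto u Filter.atTop (nhds 0)) (hx₁ : 0 ≤ x₁) (hω : 0 < ω)
    (hωA : (x₁ + Real.pi / (2 * ω)) ^ 2 ≤ A - ω ^ 2) : ¬ ∀ x, x₁ ≤ x → v x < 0 := by
  intro hneg
  have hpi : 0 < Real.pi / (2 * ω) := by positivity
  have hanti : StrictAntiOn u (Set.Ici x₁) :=
    strictAntiOn_of_deriv_neg (convex_Ici x₁)
      (fun x _ => (hu x).continuousAt.continuousWithinAt)
      (fun x hx => by
        rw [(hu x).deriv]
        exact hneg x (interior_subset hx))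
  have hpos : ∀ x, x₁ ≤ x → 0 < u x := by
    intro x hx
    have h1 : u (x + 1) < u x := hanti hx (show x₁ ≤ x + 1 by linarith) (by linarith)
    refine lt_of_le_of_lt (le_of_tendsto hu0 ?_) h1
    filter_upwards [Filter.eventually_ge_atTop (x + 1)] with y hy
    exact hanti.antitoneOn (show x₁ ≤ x + 1 by linarith) (show x₁ ≤ y by linarith) hy
  -- the Wronskian of `u` with `cos (ω (x - x₁))`
  have hlin : ∀ x, HasDerivAt (fun x => ω * (x - x₁)) ω x := fun x => by
    simpa using ((hasDerivAt_id x).sub_const x₁).const_mul ω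
  have hW : ∀ x, HasDerivAt (fun x => v x * Real.cos (ω * (x - x₁)) +
      u x * ω * Real.sin (ω * (x - x₁)))
      ((ω ^ 2 - (A - x ^ 2)) * u x * Real.cos (ω * (x - x₁))) x := fun x => by
    refine (((hv x).mul (hlin x).cos).add
      (((hu x).mul_const ω).mul (hlin x).sin)).congr_deriv ?_
    ring
  have hWanti := antitoneOn_of_deriv_nonpos (convex_Icc x₁ (x₁ + Real.pi / (2 * ω)))
    (fun x _ => (hW x).continuousAt.continuousWithinAt)
    (fun x _ => (hW x).differentiableAt.differentiableWithinAt)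
    (fun x hx => by
      rw [(hW x).deriv]
      have hx' := interior_subset hx
      have h1 : ω ^ 2 - (A - x ^ 2) ≤ 0 := by
        have := pow_le_pow_left₀ (hx₁.trans hx'.1) hx'.2 2
        linarith
      have h2 : 0 ≤ Real.cos (ω * (x - x₁)) := by
        apply Real.cos_nonneg_of_mem_Icc
        have h3 : 0 ≤ ω * (x - x₁) := mul_nonneg hω.le (by linarith [hx'.1])
        have h4 : ω * (x - x₁) ≤ ω * (Real.pi / (2 * ω)) :=
          mul_le_mul_of_nonneg_left (by linarith [hx'.2]) hω.le
        have h5 : ω * (Real.pi / (2 * ω)) = Real.pi / 2 := by field_simp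
        constructor <;> linarith [Real.pi_pos]
      exact mul_nonpos_of_nonpos_of_nonneg
        (mul_nonpos_of_nonpos_of_nonneg h1 (hpos x hx'.1).le) h2)
  have h := hWanti (Set.left_mem_Icc.2 (by linarith)) (Set.right_mem_Icc.2 (by linarith))
    (by linarith)
  have h5 : ω * (x₁ + Real.pi / (2 * ω) - x₁) = Real.pi / 2 := by
    field_simp
    ring
  simp only [h5, sub_self, mul_zero, Real.cos_zero, Real.sin_zero, Real.cos_pi_div_two,
    Real.sin_pi_div_two] at h
  have h6 := hneg x₁ le_rfl
  have h7 := mul_pos (hpos (x₁ + Real.pi / (2 * ω)) (by linarith)) hω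
  linarith

/-- Sturm comparison with `cos (ω (x - x₁))`: if `A - x ^ 2 ≥ ω ^ 2` on a quarter period
after `x₁`, a solution decaying at infinity has a critical point beyond `x₁`. -/
theorem exists_critical_point {A x₁ ω : ℝ} {u v : ℝ → ℝ}
    (hu : ∀ x, HasDerivAt u (v x) x) (hv : ∀ x, HasDerivAt v (-(A - x ^ 2) * u x) x)
    (hu0 : Filter.Tendsto u Filter.atTop (nhds 0)) (hx₁ : 0 ≤ x₁) (hω : 0 < ω)
    (hωA : (x₁ + Real.pi / (2 * ω)) ^ 2 ≤ A - ω ^ 2) : ∃ y, x₁ ≤ y ∧ v y = 0 := by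
  by_contra! hne
  have hcont : ContinuousOn v (Set.Ici x₁) := fun x _ => (hv x).continuousAt.continuousWithinAt
  have hsign : (∀ x, x₁ ≤ x → v x < 0) ∨ ∀ x, x₁ ≤ x → 0 < v x := by
    rcases lt_or_gt_of_ne (hne x₁ le_rfl) with h | h
    · left
      intro x hx
      by_contra! h2
      obtain ⟨y, hy, hy0⟩ := isPreconnected_Ici.intermediate_value (Set.mem_Ici.2 le_rfl)
        (Set.mem_Ici.2 hx) hcont ⟨h.le, h2⟩
      exact hne y hy hy0
    · right
      intro x hx
      by_contra! h2
      obtain ⟨y, hy, hy0⟩ := isPreconnected_Ici.intermediate_value (Set.mem_Ici.2 hx)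
        (Set.mem_Ici.2 le_rfl) hcont ⟨h2, h.le⟩
      exact hne y hy hy0
  rcases hsign with h | h
  · exact not_forall_deriv_neg hu hv hu0 hx₁ hω hωA h
  · refine not_forall_deriv_neg (u := -u) (v := -v) (fun x => (hu x).neg)
      (fun x => (hv x).neg.congr_deriv ?_) (neg_zero (G := ℝ) ▸ hu0.neg) hx₁ hω hωA
      (fun x hx => ?_)
    · simp
    · simpa using h x hx

/-- A function decaying at infinity and not eventually zero attains its largest square on a
half-line. -/
theorem exists_max_sq_Ici {u : ℝ → ℝ} (hc : Continuous u)
    (hu0 : Filter.Tendsto u Filter.atTop (nhds 0)) {y : ℝ} (hz : ∃ z, y ≤ z ∧ u z ≠ 0) :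
    ∃ x, y ≤ x ∧ u x ≠ 0 ∧ ∀ t, y ≤ t → u t ^ 2 ≤ u x ^ 2 := by
  obtain ⟨z, hyz, hz⟩ := hz
  have hz2 : 0 < u z ^ 2 := by positivity
  have h0 : Filter.Tendsto (fun x => u x ^ 2) Filter.atTop (nhds 0) := by simpa using hu0.pow 2
  obtain ⟨N, hN⟩ := Filter.eventually_atTop.1 (h0.eventually (gt_mem_nhds hz2))
  obtain ⟨x, hx, hmax⟩ := isCompact_Icc.exists_isMaxOn (s := Set.Icc y (max z N))
    ⟨z, hyz, le_max_left _ _⟩ (hc.pow 2).continuousOn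
  have hzx : u z ^ 2 ≤ u x ^ 2 := hmax (show z ∈ Set.Icc y (max z N) from ⟨hyz, le_max_left _ _⟩)
  refine ⟨x, hx.1, fun h => by simp [h] at hzx; exact hz hzx, fun t ht => ?_⟩
  rcases le_total t (max z N) with h | h
  · exact hmax (show t ∈ Set.Icc y (max z N) from ⟨ht, h⟩)
  · exact (hN t ((le_max_right _ _).trans h)).le.trans hzx

theorem critical_of_isLocalMax_sq {u : ℝ → ℝ} {x v : ℝ} (hu : HasDerivAt u v x)
    (hx : u x ≠ 0) (h : IsLocalMax (fun t => u t ^ 2) x) : v = 0 := by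
  have h1 := h.hasDerivAt_eq_zero (hu.pow 2)
  simpa [hx] using h1

/-! ### Bounds for solutions in units of `A ^ (1 / 6)` -/

theorem le_sqrt_of_location {A b x : ℝ} (hbA : b ^ 6 = A) (hA : 13 ≤ A)
    (hxA : x ^ 2 < A) (hx : 4 / 3 * x ≤ √(A - x ^ 2) ^ 3) (hx0 : 0 ≤ x) : b ≤ √(A - x ^ 2) := by
  have hm : 0 < √(A - x ^ 2) := Real.sqrt_pos.2 (by linarith)
  have hm2 : √(A - x ^ 2) ^ 2 = A - x ^ 2 := Real.sq_sqrt (by linarith)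
  generalize √(A - x ^ 2) = m at *
  by_contra! h
  have h3 : m ^ 3 ≤ b ^ 3 := pow_le_pow_left₀ hm.le h.le 3
  have h2 : m ^ 2 ≤ b ^ 2 := pow_le_pow_left₀ hm.le h.le 2
  have hx2 : x ^ 2 ≤ (3 / 4 * b ^ 3) ^ 2 := pow_le_pow_left₀ hx0 (by linarith) 2
  have hb2 : 2 ≤ b ^ 2 := by
    by_contra! hlt
    have := pow_lt_pow_left₀ hlt (sq_nonneg b) (n := 3) (by norm_num)
    nlinarith
  have h6 : b ^ 6 = b ^ 2 * b ^ 2 * b ^ 2 := by ring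
  have h4 : 4 ≤ b ^ 2 * b ^ 2 := by nlinarith
  nlinarith

theorem liouvilleError_le {A b x : ℝ} (hb : 0 < b) (hbA : b ^ 6 = A) (hx0 : 0 ≤ x)
    (hxA : x ^ 2 < A) :
    liouvilleError A x ≤
      5 / 12 * (b / √(A - x ^ 2)) ^ 3 + b / √(A - x ^ 2) / (12 * b ^ 4) := by
  have hm : 0 < √(A - x ^ 2) := Real.sqrt_pos.2 (by linarith)
  have hm2 : √(A - x ^ 2) ^ 2 = A - x ^ 2 := Real.sq_sqrt (by linarith)
  rw [liouvilleError]
  generalize √(A - x ^ 2) = m at *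
  have hxb : x ≤ b ^ 3 := by
    apply le_of_sq_le_sq _ (by positivity)
    nlinarith
  have h1 : x ^ 3 ≤ (b ^ 6 - m ^ 2) * b ^ 3 := by
    have := mul_le_mul_of_nonneg_left hxb (sq_nonneg x)
    nlinarith
  have h2 : 5 / 12 * (b / m) ^ 3 + b / m / (12 * b ^ 4) =
      5 / 12 * ((b ^ 6 - m ^ 2) * b ^ 3 / (A * m ^ 3)) + b ^ 3 / (2 * A * m) := by
    rw [← hbA]
    field_simp
    ring
  rw [h2]
  have hApos : 0 < A := by rw [← hbA]; positivity
  gcongr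

theorem eleven_halves_le_pow_four {A b : ℝ} (hb : 0 < b) (hbA : b ^ 6 = A) (hA : 13 ≤ A) :
    11 / 2 ≤ b ^ 4 := by
  by_contra! hlt
  have := pow_lt_pow_left₀ hlt (by positivity) (n := 3) (by norm_num)
  have h12 : (b ^ 4) ^ 3 = A ^ 2 := by rw [← hbA]; ring
  nlinarith

theorem sq_mul_le_liouvilleEnergy {A x b : ℝ} {u v : ℝ → ℝ} (hA : 13 ≤ A) (hb : 0 < b)
    (hbA : b ^ 6 = A) (hu : ∀ x, HasDerivAt u (v x) x)
    (hv : ∀ x, HasDerivAt v (-(A - x ^ 2) * u x) x) (hx0 : 0 ≤ x) (hxA : x ^ 2 < A)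
    (hx : 4 / 3 * x ≤ √(A - x ^ 2) ^ 3) :
    b * u x ^ 2 ≤ 2 * liouvilleEnergy A u v 0 := by
  have hbm := le_sqrt_of_location hbA hA hxA hx hx0
  have hI := liouvilleError_le hb hbA hx0 hxA
  have hE := (liouvilleEnergy_bounds hu hv hx0 hxA).1
  have hm : 0 < √(A - x ^ 2) := Real.sqrt_pos.2 (by linarith)
  have hE0 : 0 ≤ liouvilleEnergy A u v 0 := by rw [liouvilleEnergy]; positivity
  have hr : b / √(A - x ^ 2) ≤ 1 := (div_le_one hm).2 hbm
  have hr0 : 0 ≤ b / √(A - x ^ 2) := by positivity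
  have hb4 := eleven_halves_le_pow_four hb hbA hA
  have hI2 : liouvilleError A x ≤ 1 / 2 := by
    have h1 : (b / √(A - x ^ 2)) ^ 3 ≤ 1 := pow_le_one₀ hr0 hr
    have h2 : b / √(A - x ^ 2) / (12 * b ^ 4) ≤ 1 / 66 := by
      apply div_le_div₀ zero_le_one hr (by norm_num)
      linarith
    linarith
  have hexp : Real.exp (liouvilleError A x) ≤ 2 := by
    have h1 : Real.exp (1 / 2) ^ 2 = Real.exp 1 := by
      rw [← Real.exp_nat_mul]
      norm_num
    have h2 := Real.exp_one_lt_d9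
    have h3 : Real.exp (1 / 2) ≤ 2 := by
      apply le_of_sq_le_sq _ (by norm_num)
      rw [h1]
      linarith
    exact (Real.exp_le_exp.2 hI2).trans h3
  have h1 : √(A - x ^ 2) * u x ^ 2 ≤ liouvilleEnergy A u v x := by
    rw [liouvilleEnergy]
    exact le_add_of_nonneg_right (by positivity)
  have h2 := mul_le_mul_of_nonneg_right hbm (sq_nonneg (u x))
  have h3 := mul_le_mul_of_nonneg_left hexp hE0
  linarith

/-- The rational function of `r = A ^ (1 / 6) / √(A - x ^ 2)` that governs the lower bound; on the
range of `r` allowed by the location of the critical point it exceeds `9 / 20`. -/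
theorem lower_bound_aux {r c : ℝ} (hr : 62 / 125 ≤ r) (hr1 : r ≤ 1) (hc : c ≤ 1 / 66) :
    9 / 20 * (1 + r ^ 6 / 4) ≤ r * (1 - (5 / 12 * r ^ 3 + r * c)) := by
  have h1 : r ^ 2 * c ≤ r ^ 2 * (1 / 66) := mul_le_mul_of_nonneg_left hc (sq_nonneg r)
  -- powers of `r` are bounded by their chords on `[62 / 125, 1]`
  have c2 : r ^ 2 ≤ 187 / 125 * r - 62 / 125 := by nlinarith
  have c4 : r ^ 4 ≤ 186 / 100 * r - 86 / 100 := by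
    have : r ^ 4 - (186 / 100 * r - 86 / 100) =
      (r - 1) * (r ^ 3 + r ^ 2 + r - 86 / 100) := by ring
    have h3 : 0 ≤ r ^ 3 + r ^ 2 + r - 86 / 100 := by
      have : (62 / 125 : ℝ) ^ 3 ≤ r ^ 3 := pow_le_pow_left₀ (by norm_num) hr 3
      have : (62 / 125 : ℝ) ^ 2 ≤ r ^ 2 := pow_le_pow_left₀ (by norm_num) hr 2
      norm_num at *
      linarith
    nlinarith
  have c6 : r ^ 6 ≤ 195 / 100 * r - 95 / 100 := by
    have : r ^ 6 - (195 / 100 * r - 95 / 100) =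
      (r - 1) * (r ^ 5 + r ^ 4 + r ^ 3 + r ^ 2 + r - 95 / 100) := by ring
    have h3 : 0 ≤ r ^ 5 + r ^ 4 + r ^ 3 + r ^ 2 + r - 95 / 100 := by
      have : (62 / 125 : ℝ) ^ 5 ≤ r ^ 5 := pow_le_pow_left₀ (by norm_num) hr 5
      have : (62 / 125 : ℝ) ^ 4 ≤ r ^ 4 := pow_le_pow_left₀ (by norm_num) hr 4
      have : (62 / 125 : ℝ) ^ 3 ≤ r ^ 3 := pow_le_pow_left₀ (by norm_num) hr 3
      have : (62 / 125 : ℝ) ^ 2 ≤ r ^ 2 := pow_le_pow_left₀ (by norm_num) hr 2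
      norm_num at *
      linarith
    nlinarith
  nlinarith

theorem liouvilleEnergy_le_sq_mul {A x b : ℝ} {u v : ℝ → ℝ} (hA : 13 ≤ A) (hb : 0 < b)
    (hbA : b ^ 6 = A) (hu : ∀ x, HasDerivAt u (v x) x)
    (hv : ∀ x, HasDerivAt v (-(A - x ^ 2) * u x) x) (hx0 : 0 ≤ x) (hxA : x ^ 2 < A)
    (hvx : v x = 0) (hx : 4 / 3 * x ≤ √(A - x ^ 2) ^ 3) (hxb : A - x ^ 2 ≤ 203 / 50 * b ^ 2) :
    9 / 20 * liouvilleEnergy A u v 0 ≤ b * u x ^ 2 := by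
  have hbm := le_sqrt_of_location hbA hA hxA hx hx0
  have hI := liouvilleError_le hb hbA hx0 hxA
  have hE := (liouvilleEnergy_bounds hu hv hx0 hxA).2
  have hm : 0 < √(A - x ^ 2) := Real.sqrt_pos.2 (by linarith)
  have hm2 : √(A - x ^ 2) ^ 2 = A - x ^ 2 := Real.sq_sqrt (by linarith)
  have hE0 : 0 ≤ liouvilleEnergy A u v 0 := by rw [liouvilleEnergy]; positivity
  have hEx : liouvilleEnergy A u v x =
      √(A - x ^ 2) * u x ^ 2 * (1 + x ^ 2 / (4 * √(A - x ^ 2) ^ 6)) := by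
    rw [liouvilleEnergy, hvx]
    generalize √(A - x ^ 2) = m at *
    field_simp
    ring
  rw [hEx] at hE
  generalize √(A - x ^ 2) = m at *
  have hr1 : b / m ≤ 1 := (div_le_one hm).2 hbm
  have hr : 62 / 125 ≤ b / m := by
    rw [le_div_iff₀ hm]
    apply le_of_sq_le_sq _ hb.le
    nlinarith
  have hb4 := eleven_halves_le_pow_four hb hbA hA
  have haux := lower_bound_aux hr hr1 (c := 1 / (12 * b ^ 4)) (by
    apply one_div_le_one_div_of_le (by norm_num)
    linarith)
  have hexp : 1 - (5 / 12 * (b / m) ^ 3 + b / m * (1 / (12 * b ^ 4))) ≤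
      Real.exp (-liouvilleError A x) := by
    have h1 := Real.add_one_le_exp (-liouvilleError A x)
    have h2 : b / m * (1 / (12 * b ^ 4)) = b / m / (12 * b ^ 4) := by ring
    linarith
  have hT : x ^ 2 / (4 * m ^ 6) ≤ (b / m) ^ 6 / 4 := by
    have : (b / m) ^ 6 / 4 = b ^ 6 / (4 * m ^ 6) := by
      field_simp
    rw [this, hbA]
    gcongr
  have h1 := mul_le_mul_of_nonneg_left hexp hE0
  have h2 : m * u x ^ 2 * (1 + x ^ 2 / (4 * m ^ 6)) ≤ m * u x ^ 2 * (1 + (b / m) ^ 6 / 4) :=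
    mul_le_mul_of_nonneg_left (by linarith) (by positivity)
  have h3 := h1.trans (hE.trans h2)
  have h4 := mul_le_mul_of_nonneg_left h3 (show 0 ≤ b / m by positivity)
  have h5 := mul_le_mul_of_nonneg_left haux hE0
  have h6 : b / m * (m * u x ^ 2 * (1 + (b / m) ^ 6 / 4)) =
      b * u x ^ 2 * (1 + (b / m) ^ 6 / 4) := by
    field_simp
  rw [h6] at h4
  have h7 : 0 < 1 + (b / m) ^ 6 / 4 := by positivity
  refine le_of_mul_le_mul_right ?_ h7
  linarith

/-- Where Sturm comparison is used: with `ω = 6 b / 5` it gives a critical point at which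
`A - x ^ 2 ≤ ω ^ 2 + π b ^ 3 / ω`, and `36 / 25 + 5 π / 6 < 203 / 50`. -/
theorem exists_critical_point_near_turning_point {A b : ℝ} {u v : ℝ → ℝ} (hA : 13 ≤ A)
    (hb : 0 < b) (hbA : b ^ 6 = A) (hu : ∀ x, HasDerivAt u (v x) x)
    (hv : ∀ x, HasDerivAt v (-(A - x ^ 2) * u x) x)
    (hu0 : Filter.Tendsto u Filter.atTop (nhds 0)) :
    ∃ y, 0 ≤ y ∧ A - y ^ 2 ≤ 203 / 50 * b ^ 2 ∧ v y = 0 := by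
  have hb4 := eleven_halves_le_pow_four hb hbA hA
  have hpi := Real.pi_lt_d4
  have hpi0 := Real.pi_pos
  have hpos : 0 ≤ A - (6 / 5 * b) ^ 2 := by
    have : b ^ 6 = b ^ 4 * b ^ 2 := by ring
    nlinarith [sq_nonneg b]
  have hs2 := Real.sq_sqrt hpos
  have hs0 := Real.sqrt_nonneg (A - (6 / 5 * b) ^ 2)
  set s := √(A - (6 / 5 * b) ^ 2) with hs
  set h := Real.pi / (2 * (6 / 5 * b)) with hh
  have hhb : h * b = 5 / 12 * Real.pi := by
    rw [hh]
    field_simp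
    norm_num
  have hh0 : 0 < h := by positivity
  have hsh : h ≤ s := by
    apply le_of_sq_le_sq _ hs0
    have h1 : (h * b) ^ 2 ≤ 2 := by
      rw [hhb]
      nlinarith
    have h2 : h ^ 2 * b ^ 2 ≤ s ^ 2 * b ^ 2 := by
      rw [hs2, ← hbA]
      nlinarith
    exact le_of_mul_le_mul_right h2 (by positivity)
  obtain ⟨y, hy, hvy⟩ := exists_critical_point (x₁ := s - h) (ω := 6 / 5 * b) hu hv hu0
    (by linarith) (by positivity) (by rw [← hh, sub_add_cancel, hs2])
  refine ⟨y, by linarith, ?_, hvy⟩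
  have h1 : (s - h) ^ 2 ≤ y ^ 2 := pow_le_pow_left₀ (by linarith) hy 2
  have hsb : s ≤ b ^ 3 := by
    apply le_of_sq_le_sq _ (by positivity)
    nlinarith
  have h2 : s * h ≤ 1309 / 1000 * b ^ 2 := by
    have h3 : s * h ≤ b ^ 3 * h := mul_le_mul_of_nonneg_right hsb hh0.le
    have h4 : b ^ 3 * h = b ^ 2 * (5 / 12 * Real.pi) := by rw [← hhb]; ring
    nlinarith [sq_nonneg b]
  nlinarith [sq_nonneg h]

/-! ### The Hermite functions at the origin -/

theorem two_mul_add_one_ge {k : ℕ} (hk : 6 ≤ k) : (13 : ℝ) ≤ 2 * k + 1 := by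
  have : (6 : ℝ) ≤ k := by exact_mod_cast hk
  linarith

theorem liouvilleEnergy_zero (A : ℝ) (u v : ℝ → ℝ) :
    liouvilleEnergy A u v 0 = √A * u 0 ^ 2 + v 0 ^ 2 / √A := by
  simp [liouvilleEnergy]

theorem eval_zero_physHermite_even_sq (m : ℕ) :
    (physHermite (2 * m)).eval 0 ^ 2 = ((2 * m).factorial : ℝ) ^ 2 / (m.factorial : ℝ) ^ 2 := by
  have h := eval_zero_physHermite_even m
  rw [eq_div_iff (by positivity), ← mul_pow, h, mul_pow, ← pow_mul, mul_comm m 2, pow_mul]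
  simp

theorem hermiteC_pos {k : ℕ} (hk : 6 ≤ k) : 0 < hermiteC k := by
  have hk' : (6 : ℝ) ≤ k := by exact_mod_cast hk
  have h1 : 0 < √(4 * (k : ℝ) - 2) := Real.sqrt_pos.2 (by linarith)
  have h2 : 0 < √(8 * (k : ℝ) ^ 2 - 8 * k + 3) := Real.sqrt_pos.2 (by nlinarith)
  have h3 : 0 < √(16 * (k : ℝ) ^ 2 - 16 * k + 6) := Real.sqrt_pos.2 (by nlinarith)
  have h4 : 0 < √(2 * (k : ℝ) - 1) := Real.sqrt_pos.2 (by linarith)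
  rw [hermiteC]
  split_ifs <;> positivity

/-- The constant `C k` is, up to a factor tending to `1`, the energy at the origin. -/
theorem liouvilleEnergy_hermiteFun_zero {k : ℕ} (hk : 6 ≤ k) :
    499 / 500 * hermiteC k ≤ liouvilleEnergy (2 * k + 1) (hermiteFun k) (hermiteFunDeriv k) 0 ∧
      liouvilleEnergy (2 * k + 1) (hermiteFun k) (hermiteFunDeriv k) 0 ≤
        1003 / 1000 * hermiteC k := by
  have hk' : (6 : ℝ) ≤ k := by exact_mod_cast hk
  have hk2 : 6 * (k : ℝ) ^ 2 ≤ k ^ 3 := by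
    rw [pow_succ' (k : ℝ) 2]
    gcongr
  rw [liouvilleEnergy_zero]
  have ha : 0 < √(2 * (k : ℝ) + 1) := Real.sqrt_pos.2 (by linarith)
  have ha2 : √(2 * (k : ℝ) + 1) ^ 2 = 2 * k + 1 := Real.sq_sqrt (by linarith)
  rcases Nat.even_or_odd' k with ⟨m, hm | hm⟩
  · have hu : hermiteFun k 0 ^ 2 = (k.factorial : ℝ) ^ 2 / ((k / 2).factorial : ℝ) ^ 2 := by
      rw [hm, Nat.mul_div_cancel_left m two_pos, ← eval_zero_physHermite_even_sq]
      simp [hermiteFun]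
    have hv : hermiteFunDeriv k 0 = 0 := by
      obtain ⟨j, rfl⟩ : ∃ j, m = j + 1 := ⟨m - 1, by omega⟩
      rw [hm, show 2 * (j + 1) = (2 * j + 1) + 1 by ring, hermiteFunDeriv,
        derivative_physHermite_succ]
      simp [eval_zero_physHermite_odd]
    have hp : 0 < √(4 * (k : ℝ) - 2) := Real.sqrt_pos.2 (by linarith)
    have hp2 : √(4 * (k : ℝ) - 2) ^ 2 = 4 * k - 2 := Real.sq_sqrt (by linarith)
    have hd : 0 < √(8 * (k : ℝ) ^ 2 - 8 * k + 3) := Real.sqrt_pos.2 (by nlinarith)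
    have hd2 : √(8 * (k : ℝ) ^ 2 - 8 * k + 3) ^ 2 = 8 * k ^ 2 - 8 * k + 3 :=
      Real.sq_sqrt (by nlinarith)
    rw [hermiteC, if_pos (by rw [hm]; exact even_two_mul m), hu, hv]
    generalize √(2 * (k : ℝ) + 1) = a at *
    generalize √(4 * (k : ℝ) - 2) = p at *
    generalize √(8 * (k : ℝ) ^ 2 - 8 * k + 3) = d at *
    have hC : 2 * (k : ℝ) * p * (k.factorial : ℝ) ^ 2 / (d * ((k / 2).factorial : ℝ) ^ 2) =
        2 * k * p / d * ((k.factorial : ℝ) ^ 2 / ((k / 2).factorial : ℝ) ^ 2) := by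
      field_simp
    have hW : 0 ≤ (k.factorial : ℝ) ^ 2 / ((k / 2).factorial : ℝ) ^ 2 := by positivity
    rw [hC]
    generalize (k.factorial : ℝ) ^ 2 / ((k / 2).factorial : ℝ) ^ 2 = W at *
    have l1 : 499 / 500 * (2 * k * p / d) ≤ a := by
      rw [← mul_div_assoc, div_le_iff₀ hd]
      apply le_of_sq_le_sq _ (by positivity)
      have e1 : (499 / 500 * (2 * k * p)) ^ 2 = (499 / 500) ^ 2 * 4 * k ^ 2 * p ^ 2 := by ring
      have e2 : (a * d) ^ 2 = a ^ 2 * d ^ 2 := by ring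
      rw [e1, e2, ha2, hd2, hp2]
      nlinarith
    have l2 : a ≤ 1003 / 1000 * (2 * k * p / d) := by
      rw [← mul_div_assoc, le_div_iff₀ hd]
      apply le_of_sq_le_sq _ (by positivity)
      have e1 : (1003 / 1000 * (2 * k * p)) ^ 2 = (1003 / 1000) ^ 2 * 4 * k ^ 2 * p ^ 2 := by ring
      have e2 : (a * d) ^ 2 = a ^ 2 * d ^ 2 := by ring
      rw [e1, e2, ha2, hd2, hp2]
      nlinarith
    have := mul_le_mul_of_nonneg_right l1 hW
    have := mul_le_mul_of_nonneg_right l2 hW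
    constructor <;> · norm_num; linarith
  · have hu : hermiteFun k 0 = 0 := by simp [hermiteFun, hm, eval_zero_physHermite_odd]
    have hv : hermiteFunDeriv k 0 ^ 2 = 4 * (k : ℝ) ^ 2 * (((k - 1).factorial : ℝ) ^ 2 /
        (((k - 1) / 2).factorial : ℝ) ^ 2) := by
      rw [hm, Nat.add_sub_cancel, Nat.mul_div_cancel_left m two_pos,
        ← eval_zero_physHermite_even_sq, hermiteFunDeriv, derivative_physHermite_succ]
      simp only [eval_mul, eval_C]
      push_cast
      simp
      ring
    have hfac : (k.factorial : ℝ) = k * ((k - 1).factorial : ℝ) := by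
      rw [← Nat.mul_factorial_pred (by omega : k ≠ 0)]
      push_cast
      rfl
    have hp : 0 < √(2 * (k : ℝ) - 1) := Real.sqrt_pos.2 (by linarith)
    have hp2 : √(2 * (k : ℝ) - 1) ^ 2 = 2 * k - 1 := Real.sq_sqrt (by linarith)
    have hd : 0 < √(16 * (k : ℝ) ^ 2 - 16 * k + 6) := Real.sqrt_pos.2 (by nlinarith)
    have hd2 : √(16 * (k : ℝ) ^ 2 - 16 * k + 6) ^ 2 = 16 * k ^ 2 - 16 * k + 6 :=
      Real.sq_sqrt (by nlinarith)
    rw [hermiteC, if_neg (by rw [hm]; exact Nat.not_even_two_mul_add_one m), hu, hv, hfac]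
    generalize √(2 * (k : ℝ) + 1) = a at *
    generalize √(2 * (k : ℝ) - 1) = p at *
    generalize √(16 * (k : ℝ) ^ 2 - 16 * k + 6) = d at *
    have hC : d * (k * ((k - 1).factorial : ℝ)) * ((k - 1).factorial : ℝ) /
        (p * (((k - 1) / 2).factorial : ℝ) ^ 2) =
        d * k / p * (((k - 1).factorial : ℝ) ^ 2 / (((k - 1) / 2).factorial : ℝ) ^ 2) := by
      field_simp
    have hW : 0 ≤ ((k - 1).factorial : ℝ) ^ 2 / (((k - 1) / 2).factorial : ℝ) ^ 2 := by positivity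
    rw [hC]
    generalize ((k - 1).factorial : ℝ) ^ 2 / (((k - 1) / 2).factorial : ℝ) ^ 2 = W at *
    have e2 : (a * d) ^ 2 = a ^ 2 * d ^ 2 := by ring
    have l1 : 499 / 500 * (d * k / p) ≤ 4 * k ^ 2 / a := by
      rw [← mul_div_assoc, div_le_div_iff₀ hp ha]
      have : 499 / 500 * (a * d) ≤ 4 * k * p := by
        apply le_of_sq_le_sq _ (by positivity)
        rw [mul_pow, e2, mul_pow, ha2, hd2, hp2]
        nlinarith
      nlinarith
    have l2 : 4 * k ^ 2 / a ≤ 1003 / 1000 * (d * k / p) := by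
      rw [← mul_div_assoc, div_le_div_iff₀ ha hp]
      have : 4 * k * p ≤ 1003 / 1000 * (a * d) := by
        apply le_of_sq_le_sq _ (by positivity)
        rw [mul_pow _ (a * d), e2, mul_pow, ha2, hd2, hp2]
        nlinarith
      nlinarith
    have := mul_le_mul_of_nonneg_right l1 hW
    have := mul_le_mul_of_nonneg_right l2 hW
    have e : 4 * (k : ℝ) ^ 2 * W / a = 4 * k ^ 2 / a * W := by ring
    rw [e]
    constructor <;> · norm_num; linarith

/-! ### Bounds for the maximum -/

/-- The weighted square attains its maximum, at a critical point of the Hermite function in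
`[0, ∞)`. -/
theorem exists_isGreatest_weightedSq (k : ℕ) :
    ∃ x, 0 ≤ x ∧ hermiteFun k x ≠ 0 ∧ hermiteFunDeriv k x = 0 ∧
      IsGreatest (Set.range (weightedSq k)) (weightedSq k x) := by
  have hc : Continuous (hermiteFun k) :=
    continuous_iff_continuousAt.2 fun x => (hasDerivAt_hermiteFun k x).continuousAt
  obtain ⟨x, hx0, hux, hmax⟩ :=
    exists_max_sq_Ici hc (tendsto_hermiteFun k) (exists_hermiteFun_ne_zero k 0)
  have hall : ∀ t, weightedSq k t ≤ weightedSq k x := by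
    intro t
    rcases le_total 0 t with h | h
    · simpa only [hermiteFun_sq] using hmax t h
    · rw [← weightedSq_neg k t]
      simpa only [hermiteFun_sq] using hmax (-t) (by linarith)
  refine ⟨x, hx0, hux, critical_of_isLocalMax_sq (hasDerivAt_hermiteFun k x) hux
    (Filter.Eventually.of_forall fun t => ?_), ⟨x, rfl⟩, ?_⟩
  · simpa only [hermiteFun_sq] using hall t
  · rintro _ ⟨t, rfl⟩
    exact hall t

theorem pow_six_rpow {a : ℝ} (ha : 0 ≤ a) : (a ^ ((1 : ℝ) / 6)) ^ 6 = a := by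
  rw [← Real.rpow_natCast, ← Real.rpow_mul ha]
  norm_num

theorem hermiteM_le {k : ℕ} (hk : 6 ≤ k) : hermiteM k ≤ 1003 / 500 * hermiteC k := by
  have hA := two_mul_add_one_ge hk
  obtain ⟨x, hx0, hux, hvx, hmax⟩ := exists_isGreatest_weightedSq k
  have hloc := critical_point_location (by linarith) (hasDerivAt_hermiteFun k)
    (hasDerivAt_hermiteFunDeriv k) (tendsto_hermiteFun k) (tendsto_id_mul_hermiteFun k)
    (tendsto_hermiteFunDeriv k) hx0 hvx hux (fun t _ => by
      simpa only [hermiteFun_sq] using hmax.2 ⟨t, rfl⟩)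
  have hb : 0 < (2 * (k : ℝ) + 1) ^ ((1 : ℝ) / 6) := by positivity
  have h1 := sq_mul_le_liouvilleEnergy hA hb (pow_six_rpow (by positivity))
    (hasDerivAt_hermiteFun k) (hasDerivAt_hermiteFunDeriv k) hx0 hloc.1 hloc.2
  have h2 := (liouvilleEnergy_hermiteFun_zero hk).2
  rw [hermiteFun_sq] at h1
  have h3 : (2 * (k : ℝ)) ^ ((1 : ℝ) / 6) ≤ (2 * (k : ℝ) + 1) ^ ((1 : ℝ) / 6) :=
    Real.rpow_le_rpow (by positivity) (by linarith) (by norm_num)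
  have h4 : 0 ≤ weightedSq k x := by rw [← hermiteFun_sq]; positivity
  have h5 : ⨆ x : ℝ, weightedSq k x = weightedSq k x := hmax.csSup_eq
  rw [hermiteM, h5]
  have := mul_le_mul_of_nonneg_right h3 h4
  linarith

theorem lowerBd_lt_hermiteM {k : ℕ} (hk : 6 ≤ k) : lowerBd k < hermiteM k := by
  have hA := two_mul_add_one_ge hk
  have hC := hermiteC_pos hk
  have hu := hasDerivAt_hermiteFun k
  have hv := hasDerivAt_hermiteFunDeriv k
  have hc : Continuous (hermiteFun k) := continuous_iff_continuousAt.2 fun x => (hu x).continuousAt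
  have hb : 0 < (2 * (k : ℝ) + 1) ^ ((1 : ℝ) / 6) := by positivity
  have hbA := pow_six_rpow (show 0 ≤ 2 * (k : ℝ) + 1 by positivity)
  obtain ⟨y, hy0, hyA, hvy⟩ := exists_critical_point_near_turning_point hA hb hbA hu hv
    (tendsto_hermiteFun k)
  obtain ⟨x, hyx, hux, hmax⟩ :=
    exists_max_sq_Ici hc (tendsto_hermiteFun k) (exists_hermiteFun_ne_zero k y)
  have hvx : hermiteFunDeriv k x = 0 := by
    rcases hyx.eq_or_lt with rfl | h
    · exact hvy
    · refine critical_of_isLocalMax_sq (hu x) hux ?_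
      filter_upwards [Ioi_mem_nhds h] with t ht
      exact hmax t (le_of_lt ht)
  have hx0 := hy0.trans hyx
  have hloc := critical_point_location (by linarith) hu hv (tendsto_hermiteFun k)
    (tendsto_id_mul_hermiteFun k) (tendsto_hermiteFunDeriv k) hx0 hvx hux
    (fun t ht => hmax t (hyx.trans ht))
  have h1 := liouvilleEnergy_le_sq_mul hA hb hbA hu hv hx0 hloc.1 hvx hloc.2
    (by linarith [pow_le_pow_left₀ hy0 hyx 2])
  have h2 := (liouvilleEnergy_hermiteFun_zero hk).1
  obtain ⟨z, -, -, -, hz⟩ := exists_isGreatest_weightedSq k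
  have h3 : hermiteFun k x ^ 2 ≤ ⨆ x : ℝ, weightedSq k x := by
    rw [hermiteFun_sq]
    exact le_ciSup hz.bddAbove x
  have h4 : 493 / 500 * (2 * (k : ℝ) + 1) ^ ((1 : ℝ) / 6) ≤ (2 * (k : ℝ)) ^ ((1 : ℝ) / 6) := by
    have hk' : (6 : ℝ) ≤ k := by exact_mod_cast hk
    refine le_of_pow_le_pow_left₀ (n := 6) (by norm_num) (by positivity) ?_
    rw [mul_pow, pow_six_rpow (by positivity), pow_six_rpow (by positivity)]
    norm_num
    linarith
  have h5 : 493 / 500 * ((2 * (k : ℝ) + 1) ^ ((1 : ℝ) / 6) * hermiteFun k x ^ 2) ≤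
      hermiteM k := by
    rw [hermiteM, ← mul_assoc]
    exact mul_le_mul h4 h3 (sq_nonneg _) (by positivity)
  rw [lowerBd]
  linarith

theorem upperBd_denominator_ge {k : ℕ} (hk : 6 ≤ k) :
    3 / 25 ≤ 4 * (2 * (k : ℝ)) ^ ((1 : ℝ) / 3) - 9 := by
  have hk' : (6 : ℝ) ≤ k := by exact_mod_cast hk
  have h : (57 / 25 : ℝ) ≤ (2 * (k : ℝ)) ^ ((1 : ℝ) / 3) := by
    refine le_of_pow_le_pow_left₀ (n := 3) (by norm_num) (by positivity) ?_
    rw [← Real.rpow_natCast (_ ^ _), ← Real.rpow_mul (by positivity)]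
    norm_num
    linarith
  linarith

theorem theorem1 :
    (∀ k : ℕ, 6 ≤ k →
      IsGreatest (Set.range (weightedSq k)) (⨆ x : ℝ, weightedSq k x) ∧
      lowerBd k < hermiteM k ∧ hermiteM k < upperBd k) ∧
    (∃ K : ℝ, 0 < K ∧ ∀ k : ℕ, 6 ≤ k →
      upperBd k ≤ K * hermiteM k ∧ hermiteM k ≤ K * lowerBd k) := by
  refine ⟨fun k hk => ⟨?_, lowerBd_lt_hermiteM hk, ?_⟩,
    2 * Real.exp 190, by positivity, fun k hk => ?_⟩
  · obtain ⟨x, -, -, -, hx⟩ := exists_isGreatest_weightedSq k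
    have h : ⨆ x : ℝ, weightedSq k x = weightedSq k x := hx.csSup_eq
    rw [h]
    exact hx
  · have hC := hermiteC_pos hk
    have hM := hermiteM_le hk
    have hd := upperBd_denominator_ge hk
    have hexp : 4 < Real.exp (15 / 8 * (1 + 12 / (4 * (2 * (k : ℝ)) ^ ((1 : ℝ) / 3) - 9))) := by
      have h1 : 0 ≤ 12 / (4 * (2 * (k : ℝ)) ^ ((1 : ℝ) / 3) - 9) :=
        div_nonneg (by norm_num) (by linarith)
      have h2 : Real.exp (1 + 7 / 8) ≤
          Real.exp (15 / 8 * (1 + 12 / (4 * (2 * (k : ℝ)) ^ ((1 : ℝ) / 3) - 9))) :=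
        Real.exp_le_exp.2 (by linarith)
      have h3 := Real.exp_one_gt_d9
      have h4 := Real.add_one_le_exp (7 / 8 : ℝ)
      rw [Real.exp_add] at h2
      nlinarith
    rw [upperBd]
    nlinarith
  · have hC := hermiteC_pos hk
    have hM := hermiteM_le hk
    have hL := lowerBd_lt_hermiteM hk
    have hd := upperBd_denominator_ge hk
    have h190 := Real.add_one_le_exp (190 : ℝ)
    have hexp : Real.exp (15 / 8 * (1 + 12 / (4 * (2 * (k : ℝ)) ^ ((1 : ℝ) / 3) - 9))) ≤
        Real.exp 190 := by
      have h1 : 12 / (4 * (2 * (k : ℝ)) ^ ((1 : ℝ) / 3) - 9) ≤ 12 / (3 / 25) :=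
        div_le_div_of_nonneg_left (by norm_num) (by norm_num) hd
      apply Real.exp_le_exp.2
      linarith
    rw [lowerBd] at hL ⊢
    rw [upperBd]
    constructor
    · have h1 := mul_le_mul_of_nonneg_left hexp (show 0 ≤ 2 / 3 * hermiteC k by positivity)
      have h2 := mul_le_mul_of_nonneg_left hL.le (Real.exp_pos 190).le
      have h3 := mul_pos hC (Real.exp_pos 190)
      linarith
    · nlinarith
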